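/- Let $n\ge 1$ and let $\psi:[0,\infty)\to[0,\infty)$ be a $C^3$ function with $\psi'>0$, $\psi''\ge 0$, $\psi'''\ge 0$ on $[0,\infty)$ such that, for $\phi(y)=y\psi'(y)$, there is a real $l<\tfrac12$ with $\phi''(y)=O\big(y^{-1/2}[\phi'(y)]^{1+l}\big)$ as $y\to\infty$; if $n>1$, suppose moreover that $\psi''(y)=O\big(y^{-1/2}[\psi'(y)]^{1+l}\big)$ as $y\to\infty$ for some real $l<\tfrac12$. Write $\langle w,z\rangle=\sum_{j=1}^n w_j\overline{z_j}$ and $|z|^2=\langle z,z\rangle$ on $\mathbb{C}^n$, and let $\mu$ be Lebesgue measure on $\mathbb{C}^n$ multiplied by the constant $(n-1)!/\pi^n$. Let $F^2_\psi$ be the Hilbert space of entire functions $f$ on $\mathbb{C}^n$ with $\int_{\mathbb{C}^n}|f(z)|^2e^{-\psi(|z|^2)}\,d\mu(z)<\infty$, with inner product $\langle f,g\rangle_\psi=\int f\,\overline{g}\,e^{-\psi(|z|^2)}\,d\mu$. Put $c_r=\int_0^\infty s^re^{-\psi(s)}\,ds$ for $r\ge 0$ and, for $p,z\in\mathbb{C}^n$,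 $$K_p(z)=\frac{1}{(n-1)!}\sum_{r=n-1}^{\infty}\frac{r(r-1)\cdots(r-n+2)}{c_r}\,\langle z,p\rangle^{\,r-n+1}$$ (this is the reproducing kernel of $F^2_\psi$ at $p$). Let $\Gamma_1(z)=C_1z+D_1$ and $\Gamma_2(z)=C_2z+D_2$, where $C_1,C_2$ are complex $n\times n$ matrices with operator norms $\|C_1\|\le 1$, $\|C_2\|\le 1$ and $D_1,D_2\in\mathbb{C}^n$. Let $U_1,U_2:\mathbb{C}^n\to\mathbb{C}$ be holomorphic functions such that the weighted composition operators $C_{U_i,\Gamma_i}f=U_i\cdot(f\circ\Gamma_i)$, $i=1,2$, are bounded operators on $F^2_\psi$. Then $C_{U_1,\Gamma_1}^*=C_{U_2,\Gamma_2}$ if and only if $$U_1(z)=c_{n-1}\,U_1(0)\,K_{\Gamma_2(0)}(z)\quad\text{and}\quad U_2(z)=c_{n-1}\,\overline{U_1(0)}\,K_{\Gamma_1(0)}(z)\qquad\text{for all }z\in\mathbb{C}^n,$$ and one of the following two (mutually exclusive) cases holds: (i) $U_1(0)=0$, $U_1\equiv 0$, $U_2\equiv 0$, $C_{U_1,\Gamma_1}=0$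 and $C_{U_2,\Gamma_2}=0$; (ii) $U_1(0)\ne 0$ and $$K_z(\Gamma_2(0))\,K_{\Gamma_1(z)}(w)=K_{\Gamma_1(0)}(w)\,K_z(\Gamma_2(w))\qquad\text{for all }z,w\in\mathbb{C}^n.$$ -/

import Mathlib

open MeasureTheory Set Filter Topology Asymptotics
open scoped ENNReal NNReal Nat ComplexConjugate InnerProductSpace

noncomputable section

namespace FockType

/-- The space `ℂⁿ` with its Euclidean norm; the product `⟨w, z⟩ = ∑ j, w j * conj (z j)` is
`inner ℂ z w` (Mathlib's inner product is conjugate-linear in the first variable). -/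
abbrev Cn (n : ℕ) := EuclideanSpace ℂ (Fin n)

/-- Lebesgue measure on `ℂⁿ`, scaled by `(n-1)! / π ^ n`. With this scaling the functions
`FockType.kernel` below are exactly the reproducing kernels of the Fock-type space; the scaling
does not affect the space, boundedness of operators or adjoints. -/
def lebesgue (n : ℕ) : Measure (Cn n) :=
  ENNReal.ofReal ((n - 1)! / Real.pi ^ n) •
    (volume : Measure (Fin n → ℂ)).map (WithLp.toLp 2)

/-- The weights: `C³` functions `ψ : [0, ∞) → [0, ∞)` (values at negative arguments are
irrelevant) with `ψ' > 0`, `ψ'' ≥ 0`, `ψ''' ≥ 0`, subject to the growth condition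
`φ''(y) = O(y ^ (-1/2) * φ'(y) ^ (1 + l))` for `φ(y) = y * ψ'(y)`, and, when `n > 1`, to the same
condition for `ψ` in place of `φ`. -/
structure FockWeight (n : ℕ) where
  /-- the function `ψ` -/
  toFun : ℝ → ℝ
  contDiffOn : ContDiffOn ℝ 3 toFun (Ici 0)
  nonneg : ∀ y, 0 ≤ y → 0 ≤ toFun y
  deriv_pos : ∀ y, 0 ≤ y → 0 < derivWithin toFun (Ici 0) y
  deriv2_nonneg : ∀ y, 0 ≤ y → 0 ≤ iteratedDerivWithin 2 toFun (Ici 0) y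
  deriv3_nonneg : ∀ y, 0 ≤ y → 0 ≤ iteratedDerivWithin 3 toFun (Ici 0) y
  growth : ∃ l : ℝ, l < 1 / 2 ∧
    (fun y => iteratedDerivWithin 2 (fun t => t * derivWithin toFun (Ici 0) t) (Ici 0) y)
      =O[atTop] (fun y : ℝ => y ^ (-(1 / 2) : ℝ) *
        (derivWithin (fun t => t * derivWithin toFun (Ici 0) t) (Ici 0) y) ^ (1 + l))
  growth_of_one_lt : 1 < n → ∃ l : ℝ, l < 1 / 2 ∧
    (fun y => iteratedDerivWithin 2 toFun (Ici 0) y)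
      =O[atTop] (fun y : ℝ => y ^ (-(1 / 2) : ℝ) * (derivWithin toFun (Ici 0) y) ^ (1 + l))

variable {n : ℕ}

instance : CoeFun (FockWeight n) (fun _ => ℝ → ℝ) := ⟨FockWeight.toFun⟩

/-- The moments `c r = ∫_0^∞ s ^ r * exp (-ψ s) ds`. -/
def moment (ψ : FockWeight n) (r : ℕ) : ℝ := ∫ s in Ioi (0 : ℝ), s ^ r * Real.exp (-ψ s)

/-- The kernel function
`K_p(z) = 1/(n-1)! * ∑_{r ≥ n-1} r (r-1) ⋯ (r-n+2) / c r * ⟨z, p⟩ ^ (r-n+1)`,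
that is, `1/(n-1)!` times the `(n-1)`-st derivative of `G(t) = ∑ t ^ r / c r` at `⟨z, p⟩`.
The terms with `r < n - 1` vanish, because `r.descFactorial (n - 1) = 0` for them. -/
def kernel (ψ : FockWeight n) (p z : Cn n) : ℂ :=
  1 / ((n - 1)! : ℂ) *
    ∑' r : ℕ, (r.descFactorial (n - 1) : ℂ) / (moment ψ r : ℂ) * (inner ℂ p z) ^ (r - (n - 1))

/-- The measure `exp (-ψ (|z|²))` times (scaled) Lebesgue measure on `ℂⁿ`. -/
def weightedMeasure (ψ : FockWeight n) : Measure (Cn n) :=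
  (lebesgue n).withDensity fun z => ENNReal.ofReal (Real.exp (-ψ (‖z‖ ^ 2)))

/-- Holomorphic functions `f` on `ℂⁿ` with `∫ |f z|² * exp (-ψ (|z|²)) < ∞`. -/
def fockSubmodule (ψ : FockWeight n) : Submodule ℂ (Cn n → ℂ) where
  carrier := {f | Differentiable ℂ f ∧ MemLp f 2 (weightedMeasure ψ)}
  add_mem' hf hg := ⟨hf.1.add hg.1, hf.2.add hg.2⟩
  zero_mem' := ⟨differentiable_const 0, MemLp.zero⟩
  smul_mem' c _ hf := ⟨hf.1.const_smul c, hf.2.const_smul c⟩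

/-- The Fock-type space `F²_ψ` of entire functions on `ℂⁿ`. -/
def FockSpace (ψ : FockWeight n) : Type := fockSubmodule ψ

namespace FockSpace

variable (ψ : FockWeight n)

instance : AddCommGroup (FockSpace ψ) := inferInstanceAs (AddCommGroup (fockSubmodule ψ))

instance : Module ℂ (FockSpace ψ) := inferInstanceAs (Module ℂ (fockSubmodule ψ))

instance : FunLike (FockSpace ψ) (Cn n) ℂ where
  coe f := f.1
  coe_injective := Subtype.val_injective

variable {ψ}

theorem ext {f g : FockSpace ψ} (h : ∀ z, f z = g z) : f = g := DFunLike.ext f g h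

theorem add_apply (f g : FockSpace ψ) (z : Cn n) : (f + g) z = f z + g z := rfl

theorem sub_apply (f g : FockSpace ψ) (z : Cn n) : (f - g) z = f z - g z := rfl

theorem smul_apply (c : ℂ) (f : FockSpace ψ) (z : Cn n) : (c • f) z = c * f z := rfl

theorem differentiable (f : FockSpace ψ) : Differentiable ℂ f := f.2.1

theorem memLp (f : FockSpace ψ) : MemLp f 2 (weightedMeasure ψ) := f.2.2

theorem measurable_density : Measurable fun z : Cn n =>
    ENNReal.ofReal (Real.exp (-ψ (‖z‖ ^ 2))) := by
  have h : Continuous fun z : Cn n => ψ (‖z‖ ^ 2) :=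
    ψ.contDiffOn.continuousOn.comp_continuous (by fun_prop) fun z => by
      simp only [mem_Ici]; positivity
  exact (Real.continuous_exp.comp h.neg).measurable.ennreal_ofReal

instance : (lebesgue n).IsAddHaarMeasure := by
  have h : ((volume : Measure (Fin n → ℂ)).map (WithLp.toLp 2)).IsAddHaarMeasure :=
    (PiLp.continuousLinearEquiv 2 ℂ (fun _ : Fin n => ℂ)).symm.isAddHaarMeasure_map volume
  exact h.smul _ (by simp; positivity) ENNReal.ofReal_ne_top

instance : (weightedMeasure ψ).IsOpenPosMeasure :=
  (withDensity_absolutelyContinuous' measurable_density.aemeasurable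
    (.of_forall fun z => by simp [Real.exp_pos])).isOpenPosMeasure

theorem integrable_mul (f g : FockSpace ψ) :
    Integrable (fun z => conj (f z) * g z) (weightedMeasure ψ) :=
  MemLp.integrable_mul (p := 2) (q := 2) f.memLp.star g.memLp

variable (ψ) in
/-- The inner product of `F²_ψ`: `inner f g = ∫ g z * conj (f z) * exp (-ψ (|z|²))`. -/
@[reducible] def core : InnerProductSpace.Core ℂ (FockSpace ψ) where
  inner f g := ∫ z, conj (f z) * g z ∂weightedMeasure ψ
  conj_inner_symm f g := by
    rw [← integral_conj]; congr 1; ext z; simp [mul_comm]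
  re_inner_nonneg f := by
    have h : (fun z => conj (f z) * f z) = fun z => ((‖f z‖ ^ 2 : ℝ) : ℂ) := by
      ext z; simp [Complex.conj_mul']
    rw [h, integral_complex_ofReal]
    exact integral_nonneg fun z => by positivity
  add_left f g h := by
    rw [← integral_add (integrable_mul f h) (integrable_mul g h)]
    congr 1; ext z; simp [add_apply, add_mul]
  smul_left f g c := by
    rw [← integral_const_mul]; congr 1; ext z; simp [smul_apply, mul_assoc]
  definite f hf := by
    have h : (fun z => conj (f z) * f z) = fun z => ((‖f z‖ ^ 2 : ℝ) : ℂ) := by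
      ext z; simp [Complex.conj_mul']
    change ∫ z, conj (f z) * f z ∂weightedMeasure ψ = 0 at hf
    have hi := integrable_mul f f
    rw [h] at hf hi
    rw [integral_complex_ofReal] at hf
    have hi' : Integrable (fun z => ‖f z‖ ^ 2) (weightedMeasure ψ) := by
      exact f.memLp.integrable_norm_pow two_ne_zero
    have h0 := (integral_eq_zero_iff_of_nonneg (fun z => by positivity) hi').1
      (by exact_mod_cast hf)
    have hc : Continuous fun z => ‖f z‖ ^ 2 := f.differentiable.continuous.norm.pow 2
    have h1 := hc.ae_eq_iff_eq (weightedMeasure ψ) continuous_const |>.1 h0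
    refine ext fun z => ?_
    have h2 : ‖f z‖ ^ 2 = 0 := congrFun h1 z
    exact norm_eq_zero.1 (pow_eq_zero_iff two_ne_zero |>.1 h2)

instance : NormedAddCommGroup (FockSpace ψ) := (core ψ).toNormedAddCommGroup

instance : InnerProductSpace ℂ (FockSpace ψ) := InnerProductSpace.ofCore (core ψ).toCore

theorem inner_def (f g : FockSpace ψ) :
    ⟪f, g⟫_ℂ = ∫ z, conj (f z) * g z ∂weightedMeasure ψ := rfl

theorem norm_sq_eq (f : FockSpace ψ) : ‖f‖ ^ 2 = ∫ z, ‖f z‖ ^ 2 ∂weightedMeasure ψ := by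
  have h : (fun z => conj (f z) * f z) = fun z => ((‖f z‖ ^ 2 : ℝ) : ℂ) := by
    ext z; simp [Complex.conj_mul']
  rw [← inner_self_eq_norm_sq (𝕜 := ℂ), inner_def, h, integral_complex_ofReal]
  simp

theorem eLpNorm_eq (f : FockSpace ψ) :
    eLpNorm f 2 (weightedMeasure ψ) = ENNReal.ofReal ‖f‖ := by
  rw [f.memLp.eLpNorm_eq_integral_rpow_norm (by norm_num) (by norm_num)]
  congr 1
  have h := norm_sq_eq f
  simp only [ENNReal.toReal_ofNat, Real.rpow_ofNat]
  rw [← h, ← one_div, ← Real.sqrt_eq_rpow, Real.sqrt_sq (norm_nonneg _)]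

theorem measurePreserving_smul (a : ℂ) (ha : ‖a‖ = 1) :
    MeasurePreserving (fun z : Cn n => a • z) (lebesgue n) (lebesgue n) := by
  have ha0 : a ≠ 0 := by rintro rfl; simp at ha
  let L : ℂ ≃ₗᵢ[ℝ] ℂ := rotation ⟨a, by simp [Submonoid.unitSphere, ha]⟩
  have h1 : MeasurePreserving (fun (z : Fin n → ℂ) i => L (z i)) volume volume :=
    volume_preserving_pi fun _ => L.measurePreserving
  have h2 : MeasurePreserving (WithLp.toLp 2 : (Fin n → ℂ) → Cn n) volume
      ((volume : Measure (Fin n → ℂ)).map (WithLp.toLp 2)) :=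
    ⟨by fun_prop, rfl⟩
  refine MeasurePreserving.smul_measure ⟨by fun_prop, ?_⟩ _
  rw [Measure.map_map (by fun_prop) (by fun_prop)]
  conv_rhs => rw [← h1.map_eq, Measure.map_map (by fun_prop) h1.measurable]
  rfl

theorem enorm_le_lintegral_circle {g : ℂ → ℂ} (hg : Differentiable ℂ g) :
    ‖g 0‖ₑ ≤ ENNReal.ofReal (2 * Real.pi)⁻¹ *
      ∫⁻ θ in Ioc 0 (2 * Real.pi), ‖g (circleMap 0 1 θ)‖ₑ := by
  have h := DiffContOnCl.circleAverage (f := g) (c := 0) (R := 1) hg.diffContOnCl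
  rw [← h, Real.circleAverage_def, intervalIntegral.integral_of_le (by positivity), enorm_smul]
  gcongr
  · rw [Real.enorm_eq_ofReal (by positivity)]
  · exact enorm_integral_le_lintegral_enorm _

theorem enorm_mul_le (f : Cn n → ℂ) (hf : Differentiable ℂ f) (z : Cn n) :
    ‖f z‖ₑ * lebesgue n (Metric.closedBall 0 1) ≤
      ∫⁻ w in Metric.closedBall 0 1, ‖f (z + w)‖ₑ ∂lebesgue n := by
  have hc := hf.continuous
  calc ‖f z‖ₑ * lebesgue n (Metric.closedBall 0 1)
      = ∫⁻ w in Metric.closedBall 0 1, ‖f z‖ₑ ∂lebesgue n := by simp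
    _ ≤ ∫⁻ w in Metric.closedBall 0 1, ENNReal.ofReal (2 * Real.pi)⁻¹ *
          (∫⁻ θ in Ioc 0 (2 * Real.pi), ‖f (z + circleMap 0 1 θ • w)‖ₑ) ∂lebesgue n := by
        refine lintegral_mono fun w => ?_
        have := enorm_le_lintegral_circle (g := fun t => f (z + t • w)) (by fun_prop)
        simpa using this
    _ = ENNReal.ofReal (2 * Real.pi)⁻¹ * ∫⁻ θ in Ioc 0 (2 * Real.pi),
          ∫⁻ w in Metric.closedBall 0 1, ‖f (z + circleMap 0 1 θ • w)‖ₑ ∂lebesgue n := by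
        have hm : Continuous fun p : Cn n × ℝ => ‖f (z + circleMap 0 1 p.2 • p.1)‖ₑ := by
          have := continuous_circleMap 0 1
          exact continuous_enorm.comp (hc.comp (by fun_prop))
        rw [lintegral_const_mul, lintegral_lintegral_swap]
        · exact hm.measurable.aemeasurable
        · exact hm.measurable.lintegral_prod_right'
    _ = ENNReal.ofReal (2 * Real.pi)⁻¹ * ∫⁻ θ in Ioc 0 (2 * Real.pi),
          ∫⁻ w in Metric.closedBall 0 1, ‖f (z + w)‖ₑ ∂lebesgue n := by
        congr 2
        ext θ
        have hp := measurePreserving_smul (n := n) (circleMap 0 1 θ) (by simp)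
        have hpre : (fun w : Cn n => circleMap 0 1 θ • w) ⁻¹' Metric.closedBall 0 1 =
            Metric.closedBall 0 1 := by
          ext w; simp [norm_smul]
        have := hp.setLIntegral_comp_preimage (s := Metric.closedBall 0 1)
          Metric.isClosed_closedBall.measurableSet (f := fun w => ‖f (z + w)‖ₑ)
          (continuous_enorm.comp (hc.comp (by fun_prop))).measurable
        rwa [hpre] at this
    _ = ∫⁻ w in Metric.closedBall 0 1, ‖f (z + w)‖ₑ ∂lebesgue n := by
        rw [setLIntegral_const, Real.volume_Ioc, mul_comm _ (ENNReal.ofReal _), ← mul_assoc,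
          ← ENNReal.ofReal_mul (by positivity)]
        rw [sub_zero, inv_mul_cancel₀ (by positivity)]
        simp

/-- Point evaluations are bounded, uniformly on bounded sets. -/
theorem exists_bound (ψ : FockWeight n) (R : ℝ) :
    ∃ C : ℝ, 0 ≤ C ∧ ∀ (f : FockSpace ψ) (z : Cn n), ‖z‖ ≤ R → ‖f z‖ ≤ C * ‖f‖ := by
  set B : Set (Cn n) := Metric.closedBall 0 (R + 1) with hB
  have hBm : MeasurableSet B := Metric.isClosed_closedBall.measurableSet
  have hψ : Continuous fun z : Cn n => ψ (‖z‖ ^ 2) :=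
    ψ.contDiffOn.continuousOn.comp_continuous (by fun_prop) fun z => by
      simp only [mem_Ici]; positivity
  obtain ⟨M, hM⟩ := (isCompact_closedBall (0 : Cn n) (R + 1)).bddAbove_image hψ.continuousOn
  have hV0 : lebesgue n (Metric.closedBall 0 1) ≠ 0 :=
    (Metric.measure_closedBall_pos _ _ one_pos).ne'
  have hVt : lebesgue n (Metric.closedBall 0 1) ≠ ⊤ := measure_closedBall_lt_top.ne
  have hfin : weightedMeasure ψ B ≠ ⊤ := by
    have h1 : weightedMeasure ψ B ≤ lebesgue n B := by
      rw [weightedMeasure, withDensity_apply _ hBm]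
      calc _ ≤ ∫⁻ z in B, 1 ∂lebesgue n := by
            refine lintegral_mono fun z => ?_
            have : 0 ≤ ψ (‖z‖ ^ 2) := ψ.nonneg _ (by positivity)
            simpa using this
        _ = _ := by simp
    exact (h1.trans_lt measure_closedBall_lt_top).ne
  set K : ℝ≥0∞ := (lebesgue n (Metric.closedBall 0 1))⁻¹ * (ENNReal.ofReal (Real.exp M) *
    weightedMeasure ψ B ^ (1 / 2 : ℝ)) with hK
  have hKt : K ≠ ⊤ := ENNReal.mul_ne_top (ENNReal.inv_ne_top.2 hV0)
    (ENNReal.mul_ne_top ENNReal.ofReal_ne_top (ENNReal.rpow_ne_top_of_nonneg (by norm_num) hfin))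
  refine ⟨K.toReal, ENNReal.toReal_nonneg, fun f z hz => ?_⟩
  have hc := f.differentiable.continuous
  have h1 : ∫⁻ w in Metric.closedBall 0 1, ‖f (z + w)‖ₑ ∂lebesgue n ≤
      ∫⁻ w in B, ‖f w‖ₑ ∂lebesgue n := by
    have hp := (measurePreserving_add_left (lebesgue n) z).setLIntegral_comp_preimage
      (s := B) hBm (f := fun w => ‖f w‖ₑ) (continuous_enorm.comp hc).measurable
    rw [← hp]
    refine lintegral_mono_set fun w hw => ?_
    simp only [Metric.mem_closedBall, dist_zero_right, mem_preimage, hB] at hw ⊢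
    exact (norm_add_le _ _).trans (by linarith)
  have h2 : ∫⁻ w in B, ‖f w‖ₑ ∂lebesgue n ≤
      ENNReal.ofReal (Real.exp M) * ∫⁻ w in B, ‖f w‖ₑ ∂weightedMeasure ψ := by
    rw [weightedMeasure, setLIntegral_withDensity_eq_setLIntegral_mul _ measurable_density
      (f := fun z => ENNReal.ofReal (Real.exp (-ψ (‖z‖ ^ 2)))) (g := fun w => ‖f w‖ₑ)
      (continuous_enorm.comp hc).measurable hBm, ← lintegral_const_mul]
    · refine setLIntegral_mono' hBm fun w hw => ?_
      have hw' : ψ (‖w‖ ^ 2) ≤ M := hM ⟨w, hw, rfl⟩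
      have : (1 : ℝ≥0∞) ≤ ENNReal.ofReal (Real.exp M) *
          ENNReal.ofReal (Real.exp (-ψ (‖w‖ ^ 2))) := by
        rw [← ENNReal.ofReal_mul (Real.exp_pos _).le, ← Real.exp_add]
        simpa using hw'
      calc ‖f w‖ₑ = 1 * ‖f w‖ₑ := (one_mul _).symm
        _ ≤ _ := by
          rw [Pi.mul_apply, ← mul_assoc]
          gcongr
    · exact measurable_density.mul (continuous_enorm.comp hc).measurable
  have h3 : ∫⁻ w in B, ‖f w‖ₑ ∂weightedMeasure ψ ≤
      ENNReal.ofReal ‖f‖ * weightedMeasure ψ B ^ (1 / 2 : ℝ) := by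
    have := eLpNorm_le_eLpNorm_mul_rpow_measure_univ (μ := (weightedMeasure ψ).restrict B)
      (f := f) (p := 1) (q := 2) (by norm_num) hc.aestronglyMeasurable
    rw [eLpNorm_one_eq_lintegral_enorm, Measure.restrict_apply_univ] at this
    have he : (1 / ENNReal.toReal 1 - 1 / ENNReal.toReal 2 : ℝ) = 1 / 2 := by norm_num
    rw [he] at this
    refine this.trans ?_
    rw [← eLpNorm_eq f]
    gcongr
    exact Measure.restrict_le_self
  have h4 : ‖f z‖ₑ ≤ K * ENNReal.ofReal ‖f‖ := by
    have h5 := (enorm_mul_le f f.differentiable z).trans (h1.trans (h2.trans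
      (mul_le_mul_right h3 _)))
    rw [← ENNReal.le_div_iff_mul_le (.inl hV0) (.inl hVt)] at h5
    refine h5.trans (le_of_eq ?_)
    rw [hK, div_eq_mul_inv]
    ring
  have h6 := ENNReal.toReal_mono (ENNReal.mul_ne_top hKt ENNReal.ofReal_ne_top) h4
  rwa [toReal_enorm, ENNReal.toReal_mul, ENNReal.toReal_ofReal (norm_nonneg _)] at h6

/-- The derivatives are bounded as well, uniformly on bounded sets. -/
theorem exists_bound_fderiv (ψ : FockWeight n) (R : ℝ) :
    ∃ C : ℝ, 0 ≤ C ∧ ∀ (f : FockSpace ψ) (z : Cn n), ‖z‖ ≤ R →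
      ‖fderiv ℂ f z‖ ≤ C * ‖f‖ := by
  obtain ⟨C, hC0, hC⟩ := exists_bound ψ (R + 1)
  refine ⟨C, hC0, fun f z hz => ContinuousLinearMap.opNorm_le_of_unit_norm (𝕜 := ℂ) (by positivity)
    fun w hw => ?_⟩
  have hd : HasDerivAt (fun t : ℂ => f (z + t • w)) (fderiv ℂ f z w) 0 := by
    have h1 : HasDerivAt (fun t : ℂ => z + t • w) w 0 := by
      simpa using ((hasDerivAt_id (0 : ℂ)).smul_const w).const_add z
    have h2 : HasFDerivAt f (fderiv ℂ f z) (z + (0 : ℂ) • w) := by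
      simpa using (f.differentiable z).hasFDerivAt
    exact h2.comp_hasDerivAt 0 h1
  have hdiff : Differentiable ℂ fun t : ℂ => f (z + t • w) :=
    f.differentiable.comp (by fun_prop)
  have := Complex.norm_deriv_le_of_forall_mem_sphere_norm_le one_pos
    (hdiff.diffContOnCl (s := Metric.ball 0 1)) (C := C * ‖f‖) fun t ht => hC f _ <| by
      have : ‖t • w‖ = 1 := by simpa [norm_smul, hw] using ht
      exact (norm_add_le _ _).trans (by linarith)
  rwa [hd.deriv, div_one] at this

instance : CompleteSpace (FockSpace ψ) := by
  refine Metric.complete_of_cauchySeq_tendsto fun u hu => ?_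
  have hpt (z : Cn n) : ∃ a, Tendsto (fun k => u k z) atTop (𝓝 a) := by
    obtain ⟨C, hC0, hC⟩ := exists_bound ψ ‖z‖
    refine cauchySeq_tendsto_of_complete (Metric.cauchySeq_iff.2 fun ε hε => ?_)
    obtain ⟨N, hN⟩ := Metric.cauchySeq_iff.1 hu (ε / (C + 1)) (by positivity)
    refine ⟨N, fun k hk m hm => ?_⟩
    have h1 := hC (u k - u m) z le_rfl
    have h2 := hN k hk m hm
    rw [dist_eq_norm, lt_div_iff₀ (by positivity)] at h2
    rw [dist_eq_norm, ← sub_apply]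
    nlinarith [norm_nonneg (u k - u m)]
  have hder (R : ℝ) : UniformCauchySeqOn (fun k => fderiv ℂ (u k)) atTop (Metric.ball 0 R) := by
    obtain ⟨C, hC0, hC⟩ := exists_bound_fderiv ψ R
    refine Metric.uniformCauchySeqOn_iff.2 fun ε hε => ?_
    obtain ⟨N, hN⟩ := Metric.cauchySeq_iff.1 hu (ε / (C + 1)) (by positivity)
    refine ⟨N, fun k hk m hm z hz => ?_⟩
    have h1 := hC (u k - u m) z (by simpa using (Metric.mem_ball.1 hz).le)
    have h2 := hN k hk m hm
    have h3 : fderiv ℂ (u k - u m) z = fderiv ℂ (u k) z - fderiv ℂ (u m) z :=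
      fderiv_sub ((u k).differentiable z) ((u m).differentiable z)
    rw [dist_eq_norm, lt_div_iff₀ (by positivity)] at h2
    rw [dist_eq_norm, ← h3]
    nlinarith [norm_nonneg (u k - u m)]
  choose g hg using hpt
  have hder' (z : Cn n) : ∃ a, Tendsto (fun k => fderiv ℂ (u k) z) atTop (𝓝 a) :=
    cauchySeq_tendsto_of_complete ((hder (‖z‖ + 1)).cauchySeq (by simp))
  choose g' hg' using hder'
  have hdg : Differentiable ℂ g := fun z =>
    (hasFDerivAt_of_tendstoUniformlyOn (Metric.isOpen_ball (x := (0 : Cn n)) (ε := ‖z‖ + 1))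
      ((hder (‖z‖ + 1)).tendstoUniformlyOn_of_tendsto fun x _ => hg' x)
      (fun k x _ => ((u k).differentiable x).hasFDerivAt) (fun x _ => hg x)
      (by simp : z ∈ Metric.ball (0 : Cn n) (‖z‖ + 1))).differentiableAt
  have hfatou (k : ℕ) (ε : ℝ) (h : ∀ᶠ m in atTop, ‖u m - u k‖ ≤ ε) :
      eLpNorm (fun z => g z - u k z) 2 (weightedMeasure ψ) ≤ ENNReal.ofReal ε := by
    refine (Lp.eLpNorm_lim_le_liminf_eLpNorm
      (fun m => (u m - u k).differentiable.continuous.aestronglyMeasurable)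
      (fun z => g z - u k z) (.of_forall fun z => (hg z).sub_const _)).trans ?_
    refine liminf_le_of_frequently_le' (h.mono fun m hm => ?_).frequently
    rw [eLpNorm_eq]
    exact ENNReal.ofReal_le_ofReal hm
  have hev (ε : ℝ) (hε : 0 < ε) : ∃ N, ∀ k ≥ N, ∀ᶠ m in atTop, ‖u m - u k‖ ≤ ε := by
    obtain ⟨N, hN⟩ := Metric.cauchySeq_iff.1 hu ε hε
    refine ⟨N, fun k hk => (eventually_ge_atTop N).mono fun m hm => ?_⟩
    rw [← dist_eq_norm]
    exact (hN m hm k hk).le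
  have hmem : MemLp g 2 (weightedMeasure ψ) := by
    obtain ⟨N, hN⟩ := hev 1 one_pos
    have h1 : MemLp (fun z => g z - u N z) 2 (weightedMeasure ψ) :=
      ⟨(hdg.continuous.sub (u N).differentiable.continuous).aestronglyMeasurable,
        (hfatou N 1 (hN N le_rfl)).trans_lt ENNReal.ofReal_lt_top⟩
    have h2 := h1.add (u N).memLp
    exact h2.congr_norm hdg.continuous.aestronglyMeasurable (.of_forall fun z => by simp)
  let G : FockSpace ψ := ⟨g, hdg, hmem⟩
  refine ⟨G, Metric.tendsto_atTop.2 fun ε hε => ?_⟩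
  obtain ⟨N, hN⟩ := hev (ε / 2) (by positivity)
  refine ⟨N, fun k hk => ?_⟩
  have h1 : eLpNorm (G - u k) 2 (weightedMeasure ψ) ≤ ENNReal.ofReal (ε / 2) :=
    hfatou k _ (hN k hk)
  rw [eLpNorm_eq, ENNReal.ofReal_le_ofReal_iff (by positivity)] at h1
  rw [dist_comm, dist_eq_norm]
  linarith

end FockSpace

/-- The bounded operator `T` on `F²_ψ` is the weighted composition operator
`f ↦ U · (f ∘ Γ)`. -/
def IsWeightedComposition {ψ : FockWeight n} (U : Cn n → ℂ) (Γ : Cn n → Cn n)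
    (T : FockSpace ψ →L[ℂ] FockSpace ψ) : Prop :=
  ∀ (f : FockSpace ψ) (z : Cn n), T f z = U z * f (Γ z)

end FockType

end

open FockType

/-!
The proof rests on the reproducing property of `kernel`. Evaluation at `p` is bounded on the
Fock-type space, so it is represented by some `kernelVec ψ p` (Riesz), and the point is to identify
this vector with the explicit series. For this, let `e m` be the function `z ↦ ⟨z, p⟩ ^ m`.
The weighted measure is invariant under linear isometries. For a unit vector `p`, averaging
`∫ f * conj (e m)` over the rotations of the orthogonal complement of `p` replaces `f z` by
`f (⟨z, p⟩ p)`, by the mean value property, and averaging over the scalar rotations `z ↦ exp (iθ) z`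
then leaves only the `m`-th Taylor coefficient of `t ↦ f (t p)`, multiplied by `∫ |⟨z, p⟩| ^ (2m)`
(`integral_conj_inner_pow_mul`). In polar coordinates that last integral is a constant independent
of the weight times the moment `c (m + n - 1)`, and the Gaussian weight `exp (-|z|²)`, for which
everything is explicit, gives the constant (`integral_inner_pow_weightedMeasure`). Hence
`⟪e m, f⟫` is an explicit multiple of the `m`-th Taylor coefficient of `t ↦ f (t p)`
(`FockSpace.inner_innerPow`).

Applied to `f = kernelVec ψ p`, with `z` in place of `p`, this gives every Taylor coefficient of
`t ↦ kernelVec ψ p (t z)`, because the inner product of `⟨·, z⟩ ^ m` with `kernelVec ψ p` is the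
conjugate of the value of the former at `p`. Summing the Taylor series at `t = 1` yields
`kernel ψ p z` (`FockSpace.kernelVec_apply`); no square integrability of the series has to be
checked.

Testing on the kernel functions, the two operators are adjoint to each other if and only if
`conj (U₁ z) * K_{Γ₁ z}(w) = U₂ w * K_z(Γ₂ w)` for all `z`, `w` (`FockSpace.adjoint_eq_iff`). As
`K_0` is the constant `1 / c (n - 1)`, setting `z = 0` or `w = 0` gives the formulas for `U₁`
and `U₂`; substituting them and cancelling `c (n - 1) * conj (U₁ 0)` leaves the stated identity
between kernels.
-/

noncomputable section

namespace FockType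

variable {n : ℕ}

/-! ### Invariance and integrability for the weighted measure -/

/-- Since `ψ` is convex, it lies above its tangent line at `0`, whose slope is positive. -/
theorem FockWeight.exists_linear_le (ψ : FockWeight n) :
    ∃ a : ℝ, 0 < a ∧ ∀ y, 0 ≤ y → a * y ≤ ψ y := by
  set d : ℝ → ℝ := derivWithin ψ (Ici 0) with hd
  have hu : UniqueDiffOn ℝ (Ici (0 : ℝ)) := uniqueDiffOn_Ici 0
  have hdc : ContDiffOn ℝ 2 d (Ici 0) := ψ.contDiffOn.derivWithin hu (by norm_num)
  have hmono : MonotoneOn d (Ici 0) := by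
    refine monotoneOn_of_deriv_nonneg (convex_Ici 0) hdc.continuousOn
      ((hdc.differentiableOn (by norm_num)).mono interior_subset) fun x hx => ?_
    rw [interior_Ici] at hx
    have h := ψ.deriv2_nonneg x hx.le
    rw [iteratedDerivWithin_succ] at h
    have he : EqOn (iteratedDerivWithin 1 ψ (Ici 0)) d (Ici 0) := fun y _ => by
      rw [iteratedDerivWithin_one]
    rwa [derivWithin_congr he (he (mem_Ici.2 hx.le)),
      derivWithin_of_mem_nhds (Ici_mem_nhds hx)] at h
  refine ⟨d 0, ψ.deriv_pos 0 le_rfl, fun y hy => ?_⟩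
  have hψd : DifferentiableOn ℝ ψ (Ici 0) := ψ.contDiffOn.differentiableOn (by norm_num)
  have h2 : MonotoneOn (fun y => ψ y - d 0 * y) (Ici 0) := by
    refine monotoneOn_of_deriv_nonneg (convex_Ici 0)
      (hψd.continuousOn.sub (by fun_prop))
      ((hψd.sub (by fun_prop)).mono interior_subset) fun x hx => ?_
    rw [interior_Ici] at hx
    have hx' : DifferentiableAt ℝ ψ x :=
      (hψd x (mem_Ici.2 hx.le)).differentiableAt (Ici_mem_nhds hx)
    have h3 : deriv (fun y => ψ y - d 0 * y) x = deriv ψ x - d 0 := by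
      have := (hx'.hasDerivAt.fun_sub ((hasDerivAt_id x).const_mul (d 0))).deriv
      simpa using this
    have h4 := hmono (mem_Ici.2 le_rfl) (mem_Ici.2 hx.le) hx.le
    rw [h3, ← derivWithin_of_mem_nhds (Ici_mem_nhds hx)]
    linarith
  have h5 := h2 (mem_Ici.2 le_rfl) (mem_Ici.2 hy) hy
  have h6 := ψ.nonneg 0 le_rfl
  simp only [mul_zero, sub_zero] at h5
  linarith

/-- The image measure is a multiple of the Haar measure `lebesgue n`, and comparing the two on the unit
ball shows that the factor is `1`. -/
theorem measurePreserving_lebesgue (L : Cn n ≃ₗᵢ[ℂ] Cn n) :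
    MeasurePreserving L (lebesgue n) (lebesgue n) := by
  refine ⟨L.continuous.measurable, ?_⟩
  have h : ((lebesgue n).map L).IsAddHaarMeasure :=
    L.toContinuousLinearEquiv.isAddHaarMeasure_map (lebesgue n)
  have h1 := Measure.isAddLeftInvariant_eq_smul ((lebesgue n).map L) (lebesgue n)
  set c := Measure.addHaarScalarFactor ((lebesgue n).map L) (lebesgue n) with hc
  have h2 : (lebesgue n).map L (Metric.closedBall 0 1) = lebesgue n (Metric.closedBall 0 1) := by
    rw [Measure.map_apply L.continuous.measurable Metric.isClosed_closedBall.measurableSet]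
    congr 1
    ext z
    simp
  have hV0 : lebesgue n (Metric.closedBall 0 1) ≠ 0 :=
    (Metric.measure_closedBall_pos _ _ one_pos).ne'
  have hVt : lebesgue n (Metric.closedBall 0 1) ≠ ⊤ := measure_closedBall_lt_top.ne
  have h3 : (c : ℝ≥0∞) * lebesgue n (Metric.closedBall 0 1) =
      1 * lebesgue n (Metric.closedBall 0 1) := by
    conv_rhs => rw [one_mul, ← h2, h1]
    rfl
  have h4 : c = 1 := by exact_mod_cast (ENNReal.mul_left_inj hV0 hVt).1 h3
  rw [h1, h4, one_smul]

theorem measurePreserving_weightedMeasure (ψ : FockWeight n) {L : Cn n → Cn n}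
    (hL : MeasurePreserving L (lebesgue n) (lebesgue n)) (hnorm : ∀ z, ‖L z‖ = ‖z‖) :
    MeasurePreserving L (weightedMeasure ψ) (weightedMeasure ψ) := by
  refine ⟨hL.measurable, ?_⟩
  ext s hs
  rw [Measure.map_apply hL.measurable hs, weightedMeasure, withDensity_apply _ hs,
    withDensity_apply _ (hL.measurable hs),
    ← hL.setLIntegral_comp_preimage hs FockSpace.measurable_density]
  simp only [hnorm]

theorem integral_weightedMeasure (ψ : FockWeight n) (F : Cn n → ℂ) :
    ∫ z, F z ∂weightedMeasure ψ = ∫ z, (Real.exp (-ψ (‖z‖ ^ 2)) : ℂ) * F z ∂lebesgue n := by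
  rw [weightedMeasure, integral_withDensity_eq_integral_toReal_smul FockSpace.measurable_density
    (by simp)]
  simp [ENNReal.toReal_ofReal, Real.exp_nonneg]

theorem integrable_norm_pow (ψ : FockWeight n) (hn : 1 ≤ n) (m : ℕ) :
    Integrable (fun z : Cn n => ‖z‖ ^ m) (weightedMeasure ψ) := by
  obtain ⟨a, ha, hψ⟩ := ψ.exists_linear_le
  have : Nonempty (Fin n) := ⟨⟨0, hn⟩⟩
  rw [weightedMeasure, integrable_withDensity_iff_integrable_smul' FockSpace.measurable_density
    (by simp)]
  have h1 : Integrable (fun z : Cn n => ‖z‖ ^ m * Real.exp (-a * ‖z‖ ^ 2)) (lebesgue n) := by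
    rw [integrable_fun_norm_addHaar (lebesgue n) (f := fun r => r ^ m * Real.exp (-a * r ^ 2))]
    have := integrableOn_rpow_mul_exp_neg_mul_sq ha
      (s := ((Module.finrank ℝ (Cn n) - 1 + m : ℕ) : ℝ)) (by
        have : (0 : ℝ) ≤ ((Module.finrank ℝ (Cn n) - 1 + m : ℕ) : ℝ) := by positivity
        linarith)
    refine this.congr_fun (fun x _ => ?_) measurableSet_Ioi
    simp only [Real.rpow_natCast, smul_eq_mul]
    ring
  refine h1.mono' ?_ (.of_forall fun z => ?_)
  · exact (FockSpace.measurable_density.ennreal_toReal.smul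
      (by fun_prop : Measurable fun z : Cn n => ‖z‖ ^ m)).aestronglyMeasurable
  · rw [norm_smul, ENNReal.toReal_ofReal (Real.exp_nonneg _), mul_comm]
    simp only [Real.norm_eq_abs, Real.abs_exp, abs_of_nonneg (pow_nonneg (norm_nonneg z) m)]
    gcongr
    have := hψ (‖z‖ ^ 2) (by positivity)
    linarith

theorem memLp_inner_pow (ψ : FockWeight n) (hn : 1 ≤ n) (p : Cn n) (m : ℕ) :
    MemLp (fun z : Cn n => inner ℂ p z ^ m) 2 (weightedMeasure ψ) := by
  rw [memLp_two_iff_integrable_sq_norm (by fun_prop)]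
  refine ((integrable_norm_pow ψ hn (2 * m)).const_mul (‖p‖ ^ (2 * m))).mono'
    (by fun_prop) (.of_forall fun z => ?_)
  rw [norm_pow, norm_norm, norm_pow, ← pow_mul, mul_comm m 2, ← mul_pow]
  gcongr
  exact norm_inner_le_norm _ _

/-- The function `z ↦ ⟨z, p⟩ ^ m`, as an element of the Fock-type space. -/
def FockSpace.innerPow (ψ : FockWeight n) (hn : 1 ≤ n) (p : Cn n) (m : ℕ) : FockSpace ψ :=
  ⟨fun z => inner ℂ p z ^ m, (innerSL ℂ p).differentiable.pow m, memLp_inner_pow ψ hn p m⟩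

theorem FockSpace.innerPow_apply (ψ : FockWeight n) (hn : 1 ≤ n) (p : Cn n) (m : ℕ) (z : Cn n) :
    FockSpace.innerPow ψ hn p m z = inner ℂ p z ^ m := rfl

theorem exists_isometry_single {u : Cn n} (hu : ‖u‖ = 1) (i : Fin n) :
    ∃ L : Cn n ≃ₗᵢ[ℂ] Cn n, L (EuclideanSpace.single i 1) = u := by
  have ho : Orthonormal ℂ (({i} : Set (Fin n)).domRestrict fun _ => u) :=
    ⟨fun _ => hu, fun a b hab => (hab (Subsingleton.elim _ _)).elim⟩
  obtain ⟨b, hb⟩ := ho.exists_orthonormalBasis_extension_of_card_eq (by simp)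
  refine ⟨b.repr.symm, ?_⟩
  rw [b.repr_symm_single, hb i rfl]

/-! ### Averaging over rotations -/

/-- Integrals against an invariant measure do not change when the integrand is averaged over a
loop of measure preserving maps. -/
theorem integral_eq_integral_average {μ : Measure (Cn n)} [SFinite μ] {L : ℝ → Cn n → Cn n}
    (hLc : Continuous fun q : Cn n × ℝ => L q.2 q.1) (hL : ∀ θ, MeasurePreserving (L θ) μ μ)
    {F G : Cn n → ℂ} (hF : Continuous F) (hFi : Integrable F μ)
    (hG : ∀ z, (2 * Real.pi)⁻¹ • ∫ θ in (0)..(2 * Real.pi), F (L θ z) = G z) :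
    Integrable G μ ∧ ∫ z, F z ∂μ = ∫ z, G z ∂μ := by
  set ν : Measure ℝ := volume.restrict (Ioc 0 (2 * Real.pi)) with hν
  have hi : Integrable (fun q : Cn n × ℝ => F (L q.2 q.1)) (μ.prod ν) := by
    have hm : AEStronglyMeasurable (fun q : Cn n × ℝ => F (L q.2 q.1)) (μ.prod ν) :=
      (hF.comp hLc).aestronglyMeasurable
    rw [integrable_prod_iff' hm]
    refine ⟨.of_forall fun θ => (hL θ).integrable_comp_of_integrable hFi, ?_⟩
    have h (θ : ℝ) : ∫ z, ‖F (L θ z)‖ ∂μ = ∫ z, ‖F z‖ ∂μ := by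
      conv_rhs => rw [← (hL θ).map_eq]
      rw [integral_map (hL θ).aemeasurable hF.norm.aestronglyMeasurable]
    simp only [h]
    exact integrable_const _
  have hG' (z : Cn n) : (2 * Real.pi)⁻¹ • ∫ θ, F (L θ z) ∂ν = G z := by
    rw [← hG z, intervalIntegral.integral_of_le (by positivity)]
  have hGi : Integrable (fun z => (2 * Real.pi)⁻¹ • ∫ θ, F (L θ z) ∂ν) μ :=
    hi.integral_prod_left.smul (2 * Real.pi)⁻¹
  simp only [hG'] at hGi
  refine ⟨hGi, ?_⟩
  calc ∫ z, F z ∂μ = (2 * Real.pi)⁻¹ • ∫ _ : ℝ, (∫ z, F z ∂μ) ∂ν := by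
        rw [integral_const, smul_smul]
        have : ν.real univ = 2 * Real.pi := by simp [hν, Real.pi_pos.le]
        rw [this, inv_mul_cancel₀ (by positivity), one_smul]
    _ = (2 * Real.pi)⁻¹ • ∫ θ, (∫ z, F (L θ z) ∂μ) ∂ν := by
        congr 2 with θ
        conv_lhs => rw [← (hL θ).map_eq]
        rw [integral_map (hL θ).aemeasurable hF.aestronglyMeasurable]
    _ = (2 * Real.pi)⁻¹ • ∫ z, (∫ θ, F (L θ z) ∂ν) ∂μ := by
        rw [← integral_integral_swap (f := fun z θ => F (L θ z)) hi]
    _ = ∫ z, G z ∂μ := by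
        rw [← integral_smul]
        simp only [hG']

/-- For a unit vector `u`, multiplication by the unimodular scalar `a` on the orthogonal
complement of `u`, and the identity on the line spanned by `u`. -/
def rotateComplement (u : Cn n) (hu : ‖u‖ = 1) (a : ℂ) (ha : ‖a‖ = 1) : Cn n ≃ₗᵢ[ℂ] Cn n :=
  LinearIsometry.toLinearIsometryEquiv (R₁ := ℂ)
    { toFun := fun z => inner ℂ u z • u + a • (z - inner ℂ u z • u)
      map_add' := fun x y => by rw [inner_add_right]; module
      map_smul' := fun c x => by rw [inner_smul_right, RingHom.id_apply]; module
      norm_map' := fun z => by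
        have h0 : inner ℂ (inner ℂ u z • u) (z - inner ℂ u z • u) = 0 := by
          rw [inner_smul_left, inner_sub_right, inner_smul_right, inner_self_eq_norm_sq_to_K, hu]
          simp
        have h1 := norm_add_sq_eq_norm_sq_add_norm_sq_of_inner_eq_zero
          (𝕜 := ℂ) (inner ℂ u z • u) (z - inner ℂ u z • u) h0
        have h2 := norm_add_sq_eq_norm_sq_add_norm_sq_of_inner_eq_zero
          (𝕜 := ℂ) (inner ℂ u z • u) (a • (z - inner ℂ u z • u))
          (by rw [inner_smul_right, h0, mul_zero])
        rw [norm_smul a, ha, one_mul, ← h1, add_sub_cancel] at h2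
        exact (mul_self_inj (norm_nonneg _) (norm_nonneg _)).1 h2 } rfl

theorem rotateComplement_apply (u : Cn n) (hu : ‖u‖ = 1) (a : ℂ) (ha : ‖a‖ = 1) (z : Cn n) :
    rotateComplement u hu a ha z = inner ℂ u z • u + a • (z - inner ℂ u z • u) := rfl

/-- Cauchy's formula for the Taylor coefficients, as an average over the unit circle. -/
theorem average_inv_pow_mul {g : ℂ → ℂ} (hg : Differentiable ℂ g) (m : ℕ) :
    (2 * Real.pi)⁻¹ • ∫ θ in (0)..(2 * Real.pi), (circleMap 0 1 θ ^ m)⁻¹ * g (circleMap 0 1 θ) =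
      (m ! : ℂ)⁻¹ * iteratedDeriv m g 0 := by
  have h := hg.differentiableOn.circleIntegral_one_div_sub_center_pow_smul
    (c := 0) (R := 1) one_pos m
  rw [circleIntegral] at h
  have h1 (θ : ℝ) : deriv (circleMap 0 1) θ • (1 / (circleMap 0 1 θ - 0) ^ (m + 1)) •
      g (circleMap 0 1 θ) = Complex.I * ((circleMap 0 1 θ ^ m)⁻¹ * g (circleMap 0 1 θ)) := by
    have : circleMap 0 1 θ ≠ 0 := circleMap_ne_center one_ne_zero
    rw [deriv_circleMap]
    simp only [smul_eq_mul, sub_zero]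
    field_simp
    ring
  simp only [h1] at h
  rw [intervalIntegral.integral_const_mul, smul_eq_mul] at h
  have hI := Complex.I_ne_zero
  have hπ : (Real.pi : ℂ) ≠ 0 := by exact_mod_cast Real.pi_ne_zero
  have h2 : ∫ θ in (0)..(2 * Real.pi), (circleMap 0 1 θ ^ m)⁻¹ * g (circleMap 0 1 θ) =
      (2 * Real.pi / m !) * iteratedDeriv m g 0 := by
    apply mul_left_cancel₀ hI
    rw [h]
    ring
  rw [h2, Complex.real_smul]
  push_cast
  field_simp

/-- Pairing an entire function with `z ↦ ⟨z, u⟩ ^ m`, for a unit vector `u`, picks out the `m`-th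
Taylor coefficient of `f` along `u`. -/
theorem integral_conj_inner_pow_mul (ψ : FockWeight n) {u : Cn n} (hu : ‖u‖ = 1) (m : ℕ)
    {f : Cn n → ℂ} (hf : Differentiable ℂ f)
    (hi : Integrable (fun z => conj (inner ℂ u z ^ m) * f z) (weightedMeasure ψ)) :
    ∫ z, conj (inner ℂ u z ^ m) * f z ∂weightedMeasure ψ =
      ((m ! : ℂ)⁻¹ * iteratedDeriv m (fun t : ℂ => f (t • u)) 0) *
        ∫ z, ((‖(inner ℂ u z : ℂ)‖ ^ (2 * m) : ℝ) : ℂ) ∂weightedMeasure ψ := by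
  have : SFinite (weightedMeasure ψ) := by unfold weightedMeasure; infer_instance
  have hfc := hf.continuous
  have hcm : Continuous (circleMap 0 1) := continuous_circleMap 0 1
  have huu : inner ℂ u u = (1 : ℂ) := by rw [inner_self_eq_norm_sq_to_K, hu]; simp
  have hconj : Continuous fun z : ℂ => conj z := Complex.continuous_conj
  -- averaging over the rotations of the complement of `u` restricts `f` to the line of `u`
  obtain ⟨hi1, h1⟩ := integral_eq_integral_average (μ := weightedMeasure ψ)
    (L := fun θ => rotateComplement u hu (circleMap 0 1 θ) (by simp))
    (F := fun z => conj (inner ℂ u z ^ m) * f z)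
    (G := fun z => conj (inner ℂ u z ^ m) * f ((inner ℂ u z : ℂ) • u))
    (by simp only [rotateComplement_apply]; fun_prop)
    (fun θ => measurePreserving_weightedMeasure ψ (measurePreserving_lebesgue _)
      (LinearIsometryEquiv.norm_map _))
    (by fun_prop) hi (fun z => by
      have hin (θ : ℝ) : inner ℂ u (rotateComplement u hu (circleMap 0 1 θ) (by simp) z) =
          (inner ℂ u z : ℂ) := by
        rw [rotateComplement_apply, inner_add_right, inner_smul_right, inner_smul_right,
          inner_sub_right, inner_smul_right, huu]
        ring
      have hg : Differentiable ℂ fun t : ℂ =>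
          f ((inner ℂ u z : ℂ) • u + t • (z - (inner ℂ u z : ℂ) • u)) := by fun_prop
      have := DiffContOnCl.circleAverage (c := 0) (R := 1) hg.diffContOnCl
      rw [Real.circleAverage_def] at this
      simp only [hin]
      rw [intervalIntegral.integral_const_mul, ← mul_smul_comm]
      simp only [rotateComplement_apply]
      rw [this]
      simp)
  -- averaging over all scalar rotations extracts the Taylor coefficient
  obtain ⟨-, h2⟩ := integral_eq_integral_average (μ := weightedMeasure ψ)
    (L := fun θ z => circleMap 0 1 θ • z)
    (F := fun z => conj (inner ℂ u z ^ m) * f ((inner ℂ u z : ℂ) • u))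
    (G := fun z => ((m ! : ℂ)⁻¹ * iteratedDeriv m (fun t : ℂ => f (t • u)) 0) *
      ((‖(inner ℂ u z : ℂ)‖ ^ (2 * m) : ℝ) : ℂ))
    (by fun_prop)
    (fun θ => measurePreserving_weightedMeasure ψ
      (FockSpace.measurePreserving_smul _ (by simp)) fun z => by simp [norm_smul])
    (by fun_prop) hi1 (fun z => by
      set l : ℂ := inner ℂ u z with hl
      have hd : Differentiable ℂ fun t : ℂ => f (t • u) := by fun_prop
      have hd' : Differentiable ℂ fun t : ℂ => f ((l * t) • u) := by fun_prop
      have h3 := average_inv_pow_mul hd' m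
      rw [iteratedDeriv_comp_const_mul (f := fun t : ℂ => f (t • u)) hd.contDiff l] at h3
      have h4 (θ : ℝ) : conj (inner ℂ u (circleMap 0 1 θ • z) ^ m) *
          f ((inner ℂ u (circleMap 0 1 θ • z) : ℂ) • u) =
          conj (l ^ m) * ((circleMap 0 1 θ ^ m)⁻¹ * f ((l * circleMap 0 1 θ) • u)) := by
        have h5 : conj (circleMap 0 1 θ) = (circleMap 0 1 θ)⁻¹ :=
          (Complex.inv_eq_conj (by simp)).symm
        rw [inner_smul_right, ← hl, map_pow, map_mul, h5, mul_comm _ l, mul_pow, map_pow, inv_pow]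
        ring
      simp only [h4]
      rw [intervalIntegral.integral_const_mul, ← mul_smul_comm, h3, pow_mul]
      simp only [mul_zero]
      have h6 : ((‖l‖ ^ 2) ^ m : ℝ) = (‖l ^ m‖ ^ 2 : ℝ) := by rw [norm_pow]; ring
      rw [h6]
      push_cast
      rw [← Complex.conj_mul']
      ring)
  rw [h1, h2, integral_const_mul]

/-! ### Moments of the coordinate functions -/

/-- Polar coordinates and the substitution `s = ‖z‖ ^ 2`. The constant `S` does not depend on the
radial weight `w`, so it can be computed from a single weight. -/
theorem exists_integral_inner_pow_mul_eq (hn : 1 ≤ n) (u : Cn n) (m : ℕ) :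
    ∃ S : ℝ, ∀ w : ℝ → ℝ, ∫ z, ‖(inner ℂ u z : ℂ)‖ ^ (2 * m) * w (‖z‖ ^ 2) ∂lebesgue n =
      S * ∫ s in Ioi (0 : ℝ), s ^ (m + n - 1) * w s := by
  have : Nonempty (Fin n) := ⟨⟨0, hn⟩⟩
  have hdim : Module.finrank ℝ (Cn n) = 2 * n := by
    rw [finrank_real_of_complex]; simp
  set μ := lebesgue n
  refine ⟨(∫ x : Metric.sphere (0 : Cn n) 1, ‖(inner ℂ u (x : Cn n) : ℂ)‖ ^ (2 * m) ∂μ.toSphere) *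
    2⁻¹, fun w => ?_⟩
  have h1 : ∫ z, ‖(inner ℂ u z : ℂ)‖ ^ (2 * m) * w (‖z‖ ^ 2) ∂μ =
      ∫ x, ‖(inner ℂ u (x.1 : Cn n) : ℂ)‖ ^ (2 * m) * ((x.2 : ℝ) ^ (2 * m) * w ((x.2 : ℝ) ^ 2))
        ∂μ.toSphere.prod (.volumeIoiPow (Module.finrank ℝ (Cn n) - 1)) := by
    rw [← μ.measurePreserving_homeomorphUnitSphereProd.integral_comp
      (Homeomorph.measurableEmbedding _)]
    conv_lhs => rw [← restrict_compl_singleton (μ := μ) 0]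
    rw [← integral_subtype_comap (measurableSet_singleton _).compl]
    congr 1
    ext z
    have hz : ‖(z : Cn n)‖ ≠ 0 := norm_ne_zero_iff.2 z.2
    have h2 : (inner ℂ u (z : Cn n) : ℂ) =
        (‖(z : Cn n)‖ : ℂ) * inner ℂ u ((homeomorphUnitSphereProd (Cn n) z).1 : Cn n) := by
      rw [homeomorphUnitSphereProd_apply_fst_coe, ← Complex.coe_smul, inner_smul_right]
      have hz' : (‖(z : Cn n)‖ : ℂ) ≠ 0 := by exact_mod_cast hz
      push_cast
      rw [mul_inv_cancel_left₀ hz']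
    rw [homeomorphUnitSphereProd_apply_snd_coe, h2, norm_mul, mul_pow]
    simp only [Complex.norm_real, norm_norm]
    ring
  -- the dimension `2 * n` is real, so the radial density is `r ^ (2 * n - 1)`
  have h3 : ∫ r : Ioi (0 : ℝ), (r : ℝ) ^ (2 * m) * w ((r : ℝ) ^ 2)
      ∂.volumeIoiPow (Module.finrank ℝ (Cn n) - 1) =
      2⁻¹ * ∫ s in Ioi (0 : ℝ), s ^ (m + n - 1) * w s := by
    rw [← integral_comp_rpow_Ioi_of_pos (g := fun s => s ^ (m + n - 1) * w s) two_pos,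
      ← integral_const_mul]
    simp only [Measure.volumeIoiPow, ENNReal.ofReal]
    rw [integral_withDensity_eq_integral_smul
        (measurable_subtype_coe.pow_const _).real_toNNReal,
      integral_subtype_comap measurableSet_Ioi fun a : ℝ =>
        Real.toNNReal (a ^ (Module.finrank ℝ (Cn n) - 1)) • (a ^ (2 * m) * w (a ^ 2))]
    refine setIntegral_congr_fun measurableSet_Ioi fun x hx => ?_
    obtain ⟨k, rfl⟩ := Nat.exists_eq_add_of_le hn
    rw [NNReal.smul_def, Real.coe_toNNReal _ (pow_nonneg hx.out.le _), hdim]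
    have e1 : 2 * (1 + k) - 1 = 2 * k + 1 := by omega
    have e2 : m + (1 + k) - 1 = m + k := by omega
    have e3 : (2 - 1 : ℝ) = 1 := by norm_num
    rw [e1, e2, e3, Real.rpow_one, Real.rpow_two]
    simp only [smul_eq_mul]
    ring
  rw [h1, integral_prod_mul (μ := μ.toSphere)
    (f := fun x : Metric.sphere (0 : Cn n) 1 => ‖(inner ℂ u (x : Cn n) : ℂ)‖ ^ (2 * m))
    (g := fun r : Ioi (0 : ℝ) => (r : ℝ) ^ (2 * m) * w ((r : ℝ) ^ 2)), h3]
  ring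

theorem integral_norm_pow_mul_exp_neg_sq (m : ℕ) :
    ∫ x : ℂ, ‖x‖ ^ (2 * m) * Real.exp (-‖x‖ ^ 2) = Real.pi * m ! := by
  have h := Complex.integral_rpow_mul_exp_neg_rpow (p := 2) (q := ((2 * m : ℕ) : ℝ)) (by norm_num)
    (by have : (0 : ℝ) ≤ ((2 * m : ℕ) : ℝ) := by positivity
        linarith)
  simp only [Real.rpow_natCast, Real.rpow_two] at h
  rw [h]
  have : (((2 * m : ℕ) : ℝ) + 2) / 2 = m + 1 := by push_cast; ring
  rw [this, Real.Gamma_nat_eq_factorial]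
  ring

theorem integral_inner_pow_mul_exp_neg_sq (hn : 1 ≤ n) {u : Cn n} (hu : ‖u‖ = 1) (m : ℕ) :
    ∫ z, ‖(inner ℂ u z : ℂ)‖ ^ (2 * m) * Real.exp (-‖z‖ ^ 2) ∂lebesgue n = (n - 1)! * m ! := by
  -- `u` is moved to a coordinate vector, and the integral then splits into a product
  set i : Fin n := ⟨0, hn⟩
  obtain ⟨L, hL⟩ := exists_isometry_single hu i
  rw [← (measurePreserving_lebesgue L).integral_comp L.toHomeomorph.measurableEmbedding, ← hL]
  simp only [LinearIsometryEquiv.inner_map_map, LinearIsometryEquiv.norm_map]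
  rw [lebesgue, integral_smul_measure, ← MeasurableEquiv.coe_toLp, integral_map_equiv]
  have h1 (x : Fin n → ℂ) :
      ‖(inner ℂ (EuclideanSpace.single i (1 : ℂ)) (WithLp.toLp 2 x : Cn n) : ℂ)‖ ^ (2 * m) *
        Real.exp (-‖(WithLp.toLp 2 x : Cn n)‖ ^ 2) =
      ∏ j, (‖x j‖ ^ (2 * if j = i then m else 0) * Real.exp (-‖x j‖ ^ 2)) := by
    rw [Finset.prod_mul_distrib, ← Real.exp_sum, EuclideanSpace.norm_sq_eq,
      Finset.sum_neg_distrib, EuclideanSpace.inner_single_left]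
    congr 1
    rw [Finset.prod_eq_single i]
    · simp
    · intro j _ hj
      simp [hj]
    · simp
  simp only [MeasurableEquiv.coe_toLp, h1]
  rw [integral_fintype_prod_volume_eq_prod
    (f := fun j (y : ℂ) => ‖y‖ ^ (2 * if j = i then m else 0) * Real.exp (-‖y‖ ^ 2))]
  simp only [integral_norm_pow_mul_exp_neg_sq]
  rw [Finset.prod_mul_distrib, Finset.prod_const, Finset.card_univ, Fintype.card_fin,
    Finset.prod_eq_single i (by intro j _ hj; simp [hj]) (by simp),
    ENNReal.toReal_ofReal (by positivity)]
  have hπ := Real.pi_ne_zero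
  simp only [if_true, smul_eq_mul]
  field_simp

/-- The constant in `exists_integral_inner_pow_mul_eq` comes from the Gaussian weight
`w s = exp (-s)`. -/
theorem integral_inner_pow_weightedMeasure (ψ : FockWeight n) (hn : 1 ≤ n) {u : Cn n}
    (hu : ‖u‖ = 1) (m : ℕ) :
    ∫ z, ((‖(inner ℂ u z : ℂ)‖ ^ (2 * m) : ℝ) : ℂ) ∂weightedMeasure ψ =
      (n - 1)! * m ! / (m + n - 1)! * (moment ψ (m + n - 1) : ℂ) := by
  obtain ⟨S, hS⟩ := exists_integral_inner_pow_mul_eq hn u m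
  have h1 := hS fun s => Real.exp (-s)
  rw [integral_inner_pow_mul_exp_neg_sq hn hu] at h1
  have h2 : ∫ s in Ioi (0 : ℝ), s ^ (m + n - 1) * Real.exp (-s) = (m + n - 1)! := by
    rw [← Real.Gamma_nat_eq_factorial, Real.Gamma_eq_integral (by positivity)]
    refine setIntegral_congr_fun measurableSet_Ioi fun x _ => ?_
    simp only [add_sub_cancel_right, Real.rpow_natCast]
    ring
  rw [h2] at h1
  have h3 : S = (n - 1)! * m ! / (m + n - 1)! := by
    rw [h1, mul_div_cancel_right₀]
    positivity
  have h4 := hS fun s => Real.exp (-ψ s)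
  rw [h3] at h4
  rw [integral_weightedMeasure]
  have h5 : (∫ z : Cn n, (Real.exp (-ψ (‖z‖ ^ 2)) : ℂ) *
      ((‖(inner ℂ u z : ℂ)‖ ^ (2 * m) : ℝ) : ℂ) ∂lebesgue n) =
      ((∫ z : Cn n, ‖(inner ℂ u z : ℂ)‖ ^ (2 * m) *
        Real.exp (-ψ (‖z‖ ^ 2)) ∂lebesgue n : ℝ) : ℂ) := by
    rw [← integral_complex_ofReal]
    congr 1
    ext z
    push_cast
    ring
  rw [h5, h4, moment]
  push_cast
  rfl

/-! ### The reproducing kernel -/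

namespace FockSpace

/-- The inner products with `z ↦ ⟨z, p⟩ ^ m` are, up to explicit factors, the Taylor coefficients
at `0` along the line spanned by `p`. -/
theorem inner_innerPow (ψ : FockWeight n) (hn : 1 ≤ n) (p : Cn n) (m : ℕ) (f : FockSpace ψ) :
    ⟪innerPow ψ hn p m, f⟫_ℂ = ((n - 1)! * m ! / (m + n - 1)! * (moment ψ (m + n - 1) : ℂ)) *
      ((m ! : ℂ)⁻¹ * iteratedDeriv m (fun t : ℂ => f (t • p)) 0) := by
  -- writing `p` as a multiple of a unit vector also covers `p = 0`
  obtain ⟨u, hu, hp⟩ : ∃ u : Cn n, ‖u‖ = 1 ∧ p = (‖p‖ : ℂ) • u := by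
    by_cases h : p = 0
    · exact ⟨EuclideanSpace.single ⟨0, hn⟩ 1, by simp, by simp [h]⟩
    · have h' : (‖p‖ : ℂ) ≠ 0 := by exact_mod_cast norm_ne_zero_iff.2 h
      exact ⟨(‖p‖ : ℂ)⁻¹ • p, by simp [norm_smul, norm_ne_zero_iff.2 h],
        by rw [smul_smul, mul_inv_cancel₀ h', one_smul]⟩
  have hd : Differentiable ℂ fun t : ℂ => f (t • u) :=
    f.differentiable.comp (by fun_prop)
  have h1 : (fun t : ℂ => f (t • p)) = fun t => f (((‖p‖ : ℂ) * t) • u) := by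
    ext t
    rw [mul_comm, mul_smul, ← hp]
  have h2 (z : Cn n) : conj (innerPow ψ hn p m z) * f z =
      (‖p‖ : ℂ) ^ m * (conj (inner ℂ u z ^ m) * f z) := by
    have h3 : (inner ℂ p z : ℂ) = ‖p‖ * inner ℂ u z := by
      conv_lhs => rw [hp, inner_smul_left, Complex.conj_ofReal]
    rw [innerPow_apply, h3, mul_pow, map_mul, map_pow, Complex.conj_ofReal]
    ring
  rw [inner_def, h1]
  simp only [h2]
  rw [integral_const_mul, integral_conj_inner_pow_mul ψ hu m f.differentiable
    (integrable_mul (innerPow ψ hn u m) f), integral_inner_pow_weightedMeasure ψ hn hu,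
    iteratedDeriv_comp_const_mul (f := fun t : ℂ => f (t • u)) hd.contDiff]
  simp only [mul_zero]
  ring

/-- If the moment vanished, `z ↦ ⟨z, u⟩ ^ m` would have norm zero by `inner_innerPow`, although its
value at a unit vector `u` is `1`. -/
theorem moment_ne_zero (ψ : FockWeight n) (hn : 1 ≤ n) (m : ℕ) : moment ψ (m + n - 1) ≠ 0 := by
  intro h
  set u : Cn n := EuclideanSpace.single ⟨0, hn⟩ 1 with hu
  have h1 := inner_innerPow ψ hn u m (innerPow ψ hn u m)
  rw [h, Complex.ofReal_zero, mul_zero, zero_mul, inner_self_eq_zero] at h1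
  have h2 : innerPow ψ hn u m u = 0 := by rw [h1]; rfl
  rw [innerPow_apply] at h2
  simp [hu] at h2

/-- Evaluation at `p`, as a bounded functional. -/
def evalCLM (ψ : FockWeight n) (p : Cn n) : FockSpace ψ →L[ℂ] ℂ :=
  LinearMap.mkContinuousOfExistsBound
    { toFun := fun f => f p
      map_add' := fun _ _ => rfl
      map_smul' := fun _ _ => rfl }
    (let ⟨C, _, hC⟩ := exists_bound ψ ‖p‖; ⟨C, fun f => hC f p le_rfl⟩)

/-- The element of the Fock-type space representing evaluation at `p`. -/
def kernelVec (ψ : FockWeight n) (p : Cn n) : FockSpace ψ :=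
  (InnerProductSpace.toDual ℂ (FockSpace ψ)).symm (evalCLM ψ p)

theorem inner_kernelVec (ψ : FockWeight n) (p : Cn n) (f : FockSpace ψ) :
    ⟪kernelVec ψ p, f⟫_ℂ = f p :=
  InnerProductSpace.toDual_symm_apply

/-- The explicit series is the reproducing kernel: it is the Taylor series of
`t ↦ kernelVec ψ p (t • z)`, evaluated at `t = 1`. -/
theorem kernelVec_apply (ψ : FockWeight n) (hn : 1 ≤ n) (p z : Cn n) :
    kernelVec ψ p z = kernel ψ p z := by
  have hd : Differentiable ℂ fun t : ℂ => kernelVec ψ p (t • z) :=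
    (kernelVec ψ p).differentiable.comp (by fun_prop)
  have h1 := Complex.hasSum_taylorSeries_of_entire hd 0 1
  rw [one_smul] at h1
  set g : ℕ → ℂ := fun r => 1 / ((n - 1)! : ℂ) *
    ((r.descFactorial (n - 1) : ℂ) / (moment ψ r : ℂ) * (inner ℂ p z) ^ (r - (n - 1))) with hg
  have h2 (m : ℕ) : (m ! : ℂ)⁻¹ • (1 - 0 : ℂ) ^ m •
      iteratedDeriv m (fun t : ℂ => kernelVec ψ p (t • z)) 0 = g (m + (n - 1)) := by
    have h3 := inner_innerPow ψ hn z m (kernelVec ψ p)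
    rw [← inner_conj_symm, inner_kernelVec, innerPow_apply, map_pow, inner_conj_symm,
      Nat.add_sub_assoc hn] at h3
    have hc : (moment ψ (m + (n - 1)) : ℂ) ≠ 0 := by
      rw [← Nat.add_sub_assoc hn]
      exact_mod_cast moment_ne_zero ψ hn m
    have h4 := Nat.factorial_mul_descFactorial (Nat.le_add_left (n - 1) m)
    rw [Nat.add_sub_cancel] at h4
    have h5 : ((m + (n - 1))! : ℂ) = m ! * (m + (n - 1)).descFactorial (n - 1) := by
      exact_mod_cast h4.symm
    have h6 : ((m + (n - 1))! : ℂ) ≠ 0 := by exact_mod_cast Nat.factorial_ne_zero _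
    have h7 : ((n - 1)! : ℂ) ≠ 0 := by exact_mod_cast Nat.factorial_ne_zero _
    have h8 : (m ! : ℂ) ≠ 0 := by exact_mod_cast Nat.factorial_ne_zero _
    have h9 : ((m + (n - 1)).descFactorial (n - 1) : ℂ) ≠ 0 := by
      intro h
      rw [h, mul_zero] at h5
      exact h6 h5
    simp only [hg, smul_eq_mul, sub_zero, one_pow, one_mul, Nat.add_sub_cancel]
    rw [h3, h5]
    field_simp
  simp only [h2] at h1
  -- the summation index is shifted by `n - 1`; the terms below vanish
  have h10 : ∑ r ∈ Finset.range (n - 1), g r = 0 :=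
    Finset.sum_eq_zero fun r hr => by
      simp [hg, Nat.descFactorial_eq_zero_iff_lt.2 (Finset.mem_range.1 hr)]
  rw [hasSum_nat_add_iff, h10, add_zero] at h1
  rw [kernel, ← tsum_mul_left]
  exact h1.tsum_eq.symm

theorem kernel_zero_left (ψ : FockWeight n) (z : Cn n) :
    kernel ψ 0 z = (moment ψ (n - 1) : ℂ)⁻¹ := by
  have h7 : ((n - 1)! : ℂ) ≠ 0 := by exact_mod_cast Nat.factorial_ne_zero _
  rw [kernel, tsum_eq_single (n - 1)]
  · rw [Nat.descFactorial_self]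
    field_simp
    simp
  · intro r hr
    rcases lt_or_gt_of_ne hr with h | h
    · simp [Nat.descFactorial_eq_zero_iff_lt.2 h]
    · simp [inner_zero_left, (Nat.sub_pos_of_lt h).ne']

theorem conj_kernel (ψ : FockWeight n) (p z : Cn n) :
    conj (kernel ψ p z) = kernel ψ z p := by
  simp [kernel, Complex.conj_tsum, inner_conj_symm]

/-! ### Adjoints of weighted composition operators -/

/-- Two weighted composition operators are adjoint to each other if and only if they are so when
tested on kernel functions. -/
theorem adjoint_eq_iff (ψ : FockWeight n) (hn : 1 ≤ n) {U₁ U₂ : Cn n → ℂ} {Γ₁ Γ₂ : Cn n → Cn n}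
    {T₁ T₂ : FockSpace ψ →L[ℂ] FockSpace ψ}
    (hT₁ : IsWeightedComposition U₁ Γ₁ T₁) (hT₂ : IsWeightedComposition U₂ Γ₂ T₂) :
    ContinuousLinearMap.adjoint T₁ = T₂ ↔
      ∀ z w, conj (U₁ z) * kernel ψ (Γ₁ z) w = U₂ w * kernel ψ z (Γ₂ w) := by
  have h1 (z w : Cn n) : ContinuousLinearMap.adjoint T₁ (kernelVec ψ z) w =
      conj (U₁ z) * kernel ψ (Γ₁ z) w := by
    rw [← inner_kernelVec, ContinuousLinearMap.adjoint_inner_right, ← inner_conj_symm,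
      inner_kernelVec,
      hT₁, map_mul, kernelVec_apply ψ hn, conj_kernel]
  have h2 (z w : Cn n) : T₂ (kernelVec ψ z) w = U₂ w * kernel ψ z (Γ₂ w) := by
    rw [hT₂, kernelVec_apply ψ hn]
  constructor
  · rintro h z w
    rw [← h1, ← h2, h]
  · intro h
    have h3 (z : Cn n) : ContinuousLinearMap.adjoint T₁ (kernelVec ψ z) = T₂ (kernelVec ψ z) :=
      ext fun w => by rw [h1, h2, h]
    have h4 : T₁ = ContinuousLinearMap.adjoint T₂ := by
      ext1 f
      refine ext fun z => ?_
      rw [← inner_kernelVec, ← inner_kernelVec ψ z, ContinuousLinearMap.adjoint_inner_right, ← h3,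
        ContinuousLinearMap.adjoint_inner_left]
    rw [h4, ContinuousLinearMap.adjoint_adjoint]

end FockSpace

end FockType

end

theorem theorem2p4 (n : ℕ) (hn : 1 ≤ n) (ψ : FockWeight n)
    (C₁ C₂ : Matrix (Fin n) (Fin n) ℂ) (D₁ D₂ : Cn n)
    (hC₁ : ‖Matrix.toEuclideanCLM (𝕜 := ℂ) C₁‖ ≤ 1)
    (hC₂ : ‖Matrix.toEuclideanCLM (𝕜 := ℂ) C₂‖ ≤ 1)
    (Γ₁ Γ₂ : Cn n → Cn n)
    (hΓ₁ : ∀ z, Γ₁ z = Matrix.toEuclideanCLM (𝕜 := ℂ) C₁ z + D₁)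
    (hΓ₂ : ∀ z, Γ₂ z = Matrix.toEuclideanCLM (𝕜 := ℂ) C₂ z + D₂)
    (U₁ U₂ : Cn n → ℂ) (hU₁ : Differentiable ℂ U₁) (hU₂ : Differentiable ℂ U₂)
    (T₁ T₂ : FockSpace ψ →L[ℂ] FockSpace ψ)
    (hT₁ : IsWeightedComposition U₁ Γ₁ T₁) (hT₂ : IsWeightedComposition U₂ Γ₂ T₂) :
    ContinuousLinearMap.adjoint T₁ = T₂ ↔
      (∀ z, U₁ z = (moment ψ (n - 1) : ℂ) * U₁ 0 * kernel ψ (Γ₂ 0) z ∧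
        U₂ z = (moment ψ (n - 1) : ℂ) * (starRingEnd ℂ) (U₁ 0) * kernel ψ (Γ₁ 0) z) ∧
      ((U₁ 0 = 0 ∧ (∀ z, U₁ z = 0) ∧ (∀ z, U₂ z = 0) ∧ T₁ = 0 ∧ T₂ = 0) ∨
        (U₁ 0 ≠ 0 ∧ ∀ z w, kernel ψ z (Γ₂ 0) * kernel ψ (Γ₁ z) w =
          kernel ψ (Γ₁ 0) w * kernel ψ z (Γ₂ w))) := by
  set c : ℂ := (moment ψ (n - 1) : ℂ) with hc
  have hc0 : c ≠ 0 := by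
    have := FockSpace.moment_ne_zero ψ hn 0
    rw [zero_add] at this
    exact Complex.ofReal_ne_zero.2 this
  have hK0 (z : Cn n) : kernel ψ 0 z = c⁻¹ := FockSpace.kernel_zero_left ψ z
  have hK0' (z : Cn n) : kernel ψ z 0 = c⁻¹ := by
    rw [← FockSpace.conj_kernel, hK0, hc, map_inv₀, Complex.conj_ofReal]
  rw [FockSpace.adjoint_eq_iff ψ hn hT₁ hT₂]
  constructor
  · intro h
    have hU₂' (w : Cn n) : U₂ w = c * conj (U₁ 0) * kernel ψ (Γ₁ 0) w := by
      have := h 0 w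
      rw [hK0] at this
      field_simp at this
      rw [← this]
      ring
    have h00 : U₂ 0 = conj (U₁ 0) := by
      rw [hU₂' 0, hK0']
      field_simp
    have hU₁' (z : Cn n) : U₁ z = c * U₁ 0 * kernel ψ (Γ₂ 0) z := by
      have := congrArg conj (h z 0)
      rw [hK0', h00, map_mul, map_mul, Complex.conj_conj, Complex.conj_conj, map_inv₀, hc,
        Complex.conj_ofReal, ← hc, FockSpace.conj_kernel] at this
      field_simp at this
      rw [this]
    refine ⟨fun z => ⟨hU₁' z, hU₂' z⟩, ?_⟩
    by_cases h0 : U₁ 0 = 0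
    · have hz₁ (z : Cn n) : U₁ z = 0 := by rw [hU₁', h0]; ring
      have hz₂ (z : Cn n) : U₂ z = 0 := by rw [hU₂', h0, map_zero]; ring
      refine .inl ⟨h0, hz₁, hz₂, ?_, ?_⟩
      · ext1 f
        exact FockSpace.ext fun z => by rw [hT₁, hz₁, zero_mul]; rfl
      · ext1 f
        exact FockSpace.ext fun z => by rw [hT₂, hz₂, zero_mul]; rfl
    · refine .inr ⟨h0, fun z w => ?_⟩
      have h0' : c * conj (U₁ 0) ≠ 0 := mul_ne_zero hc0 (by simpa using h0)
      have := h z w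
      rw [hU₁' z, hU₂' w, map_mul, map_mul, hc, Complex.conj_ofReal, ← hc,
        FockSpace.conj_kernel, mul_assoc, mul_assoc (c * _)] at this
      exact mul_left_cancel₀ h0' this
  · rintro ⟨hU, h | ⟨-, h⟩⟩ z w
    · rw [h.2.1, h.2.2.1]
      simp
    · rw [(hU z).1, (hU w).2, map_mul, map_mul, hc, Complex.conj_ofReal,
        FockSpace.conj_kernel, mul_assoc, h z w]
      ring
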